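/- Let $N\in\mathbb{N}$, let $B_0\in\mathbb{R}^{N\times N}$ be symmetric, and let $s,y\in\mathbb{R}^N$. For $c\in\mathbb{R}^N$ with $c^\top s\neq 0$, the Dennis update of $B_0$ with parameter $c$ is $$D_c(B_0;s,y)=B_0+\frac{(y-B_0s)c^\top+c\,(y-B_0s)^\top}{c^\top s}-\frac{c\,\bigl(s^\top(y-B_0s)\bigr)\,c^\top}{(c^\top s)^2}.$$ For a symmetric positive definite $W\in\mathbb{R}^{N\times N}$, consider the following Gaussian model. The vector of elements of the matrix $B\in\mathbb{R}^{N\times N}$ has the Gaussian prior with mean $B_0$ and covariance $\Gamma(W\otimes W)\Gamma^\top$, where $(W\otimes W)_{ij,k\ell}=W_{ik}W_{j\ell}$ and $\Gamma$ is the symmetrization operator $\Gamma\overrightarrow{A}=\tfrac12\overrightarrow{(A+A^\top)}$; explicitly, $\operatorname{Cov}(B_{ij},B_{k\ell})=\tfrac12(W_{ik}W_{j\ell}+W_{jk}W_{i\ell})$. This is a prior on symmetric matrices. One observes $y=Bs$ without noise ($M=1$ observation). The posterior is the weak limit, as $\Lambda\to0$ within the positive definite $N\times N$ matrices, of the Bayesian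 posteriors for the likelihood $\mathcal{N}(y;Bs,\Lambda)$. Then the Dennis updates are exactly the posterior means in this model after one observation: 1. If $s\neq0$, then for every symmetric positive definite $W$ one has $(Ws)^\top s\neq0$, the posterior exists, and its mean is $D_c(B_0;s,y)$ with $c=Ws$. 2. For every $c\in\mathbb{R}^N$ with $c^\top s\neq0$ there is a symmetric positive definite $W$ with $Ws=\operatorname{sign}(c^\top s)\,c$ such that the posterior exists in the model with this $W$ and its mean is $D_c(B_0;s,y)$. (In particular $Ws=c$ if $c^\top s>0$. The factor $-1$ in the case $c^\top s<0$ does not change the update, since $D_{\alpha c}=D_c$ for all $\alpha\neq0$.) -/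

import Mathlib

open MeasureTheory ProbabilityTheory Matrix Filter Topology

namespace GaussQN

/-- The vector of the elements of a matrix, indexed by pairs `(i, j)` (row-by-row stacking). -/
noncomputable def rowVec {m n : Type*} [Fintype m] [Fintype n] (B : Matrix m n ℝ) :
    EuclideanSpace ℝ (m × n) :=
  WithLp.toLp 2 (fun p => B p.1 p.2)

/-- The matrix whose vector of elements is `v` (inverse of `rowVec`). -/
def unVec {m n : Type*} (v : EuclideanSpace ℝ (m × n)) : Matrix m n ℝ :=
  Matrix.of (fun i j => v (i, j))

/-- The symmetrization operator on vectorized square matrices: the matrix with elements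
`Γ_{ij,kl} = (δ_{ik} δ_{jl} + δ_{il} δ_{jk}) / 2`. -/
noncomputable def symmetrizer (n : Type*) [DecidableEq n] : Matrix (n × n) (n × n) ℝ :=
  Matrix.of (fun p q =>
    ((if p.1 = q.1 ∧ p.2 = q.2 then (1 : ℝ) else 0) +
      (if p.1 = q.2 ∧ p.2 = q.1 then (1 : ℝ) else 0)) / 2)

/-- The symmetric Kronecker product of `W` with itself, `Γ (W ⊗ W) Γᵀ`. -/
noncomputable def symKronecker {n : Type*} [Fintype n] [DecidableEq n] (W : Matrix n n ℝ) :
    Matrix (n × n) (n × n) ℝ :=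
  symmetrizer n * Matrix.kroneckerMap (fun a b => a * b) W W * (symmetrizer n)ᵀ

/-- `Γ` maps the vector of elements of `A` to that of `(A + Aᵀ) / 2`. -/
theorem symmetrizer_mulVec {n : Type*} [Fintype n] [DecidableEq n] (A : Matrix n n ℝ)
    (i j : n) :
    (symmetrizer n *ᵥ (fun p => A p.1 p.2)) (i, j) = (A i j + A j i) / 2 := by
  simp only [symmetrizer, Matrix.mulVec, dotProduct, Matrix.of_apply, Fintype.sum_prod_type]
  simp [add_div, add_mul, Finset.sum_add_distrib, ite_and, ite_div, ite_mul]
  ring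

/-- The symmetric Kronecker product is a genuine covariance matrix. -/
theorem posSemidef_symKronecker {n : Type*} [Fintype n] [DecidableEq n] {W : Matrix n n ℝ}
    (hW : W.PosDef) : (symKronecker W).PosSemidef := by
  have h := (hW.posSemidef.kronecker hW.posSemidef).mul_mul_conjTranspose_same (symmetrizer n)
  rwa [Matrix.conjTranspose_eq_transpose_of_trivial] at h

/-- The elements of the symmetric Kronecker product. -/
theorem symKronecker_apply {n : Type*} [Fintype n] [DecidableEq n] (W : Matrix n n ℝ)
    (i j k l : n) :
    symKronecker W (i, j) (k, l) = (W i k * W j l + W j k * W i l) / 2 := by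
  have hΓ : ∀ (f : n × n → ℝ) (a b : n),
      ∑ p : n × n, symmetrizer n (a, b) p * f p = (f (a, b) + f (b, a)) / 2 := fun f a b =>
    symmetrizer_mulVec (Matrix.of (fun i j => f (i, j))) a b
  have h1 : symKronecker W (i, j) (k, l) =
      ∑ q : n × n, symmetrizer n (k, l) q *
        (∑ p : n × n, symmetrizer n (i, j) p * (W p.1 q.1 * W p.2 q.2)) := by
    simp only [symKronecker, Matrix.mul_apply, Matrix.transpose_apply, Matrix.kroneckerMap_apply]
    exact Finset.sum_congr rfl (fun q _ => mul_comm _ _)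
  rw [h1]
  simp only [hΓ]
  ring

/-- The Gaussian prior with mean `B₀` and covariance `W ⊗⊖ W` (symmetric Kronecker product)
on the vector of elements of a square matrix. -/
noncomputable def prior {N : ℕ} (B₀ W : Matrix (Fin N) (Fin N) ℝ) :
    Measure (EuclideanSpace ℝ (Fin N × Fin N)) :=
  multivariateGaussian (rowVec B₀) (symKronecker W)

/-- The Gaussian density with covariance matrix `Λ`, evaluated at the deviation `r` from the
mean. -/
noncomputable def gaussianDensity {ι : Type*} [Fintype ι] [DecidableEq ι] (Λ : Matrix ι ι ℝ)
    (r : ι → ℝ) : ℝ :=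
  (Real.sqrt ((2 * Real.pi) ^ Fintype.card ι * Λ.det))⁻¹ *
    Real.exp (-(r ⬝ᵥ (Λ⁻¹ *ᵥ r)) / 2)

/-- The likelihood of the observation `Y` of `B * S` under Gaussian noise of covariance `Λ`,
as a function of the vector of elements of `B`. -/
noncomputable def likelihood {N M : ℕ} (S Y : Matrix (Fin N) (Fin M) ℝ)
    (Λ : Matrix (Fin N × Fin M) (Fin N × Fin M) ℝ)
    (v : EuclideanSpace ℝ (Fin N × Fin N)) : ℝ :=
  gaussianDensity Λ (fun p => (Y - unVec v * S) p.1 p.2)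

/-- The posterior given by Bayes' theorem for the noisy observation: the prior reweighted by the
likelihood and normalized to total mass one. -/
noncomputable def noisyPosterior {N M : ℕ} (P : Measure (EuclideanSpace ℝ (Fin N × Fin N)))
    (S Y : Matrix (Fin N) (Fin M) ℝ) (Λ : Matrix (Fin N × Fin M) (Fin N × Fin M) ℝ) :
    Measure (EuclideanSpace ℝ (Fin N × Fin N)) :=
  (∫⁻ v, ENNReal.ofReal (likelihood S Y Λ v) ∂P)⁻¹ •
    P.withDensity (fun v => ENNReal.ofReal (likelihood S Y Λ v))

/-- `Q` is the posterior under prior `P` after the noise-free observation `Y = B * S`: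
the probability measure that is the weak limit of the posteriors for noisy observations as the
(positive definite) noise covariance tends to zero. -/
def IsNoiseFreePosterior {N M : ℕ} (P : Measure (EuclideanSpace ℝ (Fin N × Fin N)))
    (S Y : Matrix (Fin N) (Fin M) ℝ) (Q : Measure (EuclideanSpace ℝ (Fin N × Fin N))) : Prop :=
  IsProbabilityMeasure Q ∧
    ∀ f : BoundedContinuousFunction (EuclideanSpace ℝ (Fin N × Fin N)) ℝ,
      Tendsto (fun Λ => ∫ v, f v ∂(noisyPosterior P S Y Λ))
        (𝓝[{Λ : Matrix (Fin N × Fin M) (Fin N × Fin M) ℝ | Λ.PosDef}] 0)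
        (𝓝 (∫ v, f v ∂Q))

/-- In the model with prior mean `B₀` and prior covariance `W ⊗⊖ W`, the posterior after the
noise-free observation `Y = B * S` exists and has mean `B₁`. -/
def IsPosteriorMean {N M : ℕ} (B₀ W : Matrix (Fin N) (Fin N) ℝ)
    (S Y : Matrix (Fin N) (Fin M) ℝ) (B₁ : Matrix (Fin N) (Fin N) ℝ) : Prop :=
  ∃ Q : Measure (EuclideanSpace ℝ (Fin N × Fin N)),
    IsNoiseFreePosterior (prior B₀ W) S Y Q ∧ Integrable (fun v => v) Q ∧
      ∫ v, v ∂Q = rowVec B₁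

/-- The Dennis update of `B₀` from the pair `(s, y)` with parameter `c`; it is meaningful
when `c ⬝ᵥ s ≠ 0`. -/
noncomputable def dennisUpdate {N : ℕ} (B₀ : Matrix (Fin N) (Fin N) ℝ) (s y c : Fin N → ℝ) :
    Matrix (Fin N) (Fin N) ℝ :=
  B₀ + (c ⬝ᵥ s)⁻¹ • (vecMulVec (y - B₀ *ᵥ s) c + vecMulVec c (y - B₀ *ᵥ s))
    - ((s ⬝ᵥ (y - B₀ *ᵥ s)) / (c ⬝ᵥ s) ^ 2) • vecMulVec c c

end GaussQN

/-! Write `A` for the map `B ↦ B s` on vectorized matrices, `C` for the prior covariance and `G = A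
C Aᵀ`. If `K G = C Aᵀ`, then `v - K A v` and `A v` are uncorrelated and jointly Gaussian, hence
independent. The prior thus splits as a product (`indepFun_sub_multivariateGaussian`). The
likelihood, read as a function of the observed vector, is the density of a Gaussian centred at `y`,
which collapses to the Dirac mass at `y` as `Λ → 0` (`tendsto_integral_likelihood`). After
normalization the limit is the law of `v - K A v + K y` under the prior, with mean `B₀ + K (y - B₀
s)`.

This needs only `G` to be invertible; `C` itself is singular for `N ≥ 2`, since it kills
antisymmetric matrices. For one observation, with `c = W s`, `G = ((c·s) W + c cᵀ) / 2` is positive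
definite plus rank one, so `G u = y - B₀ s` is solved explicitly, and `C Aᵀ u` is the Dennis
correction (`isPosteriorMean_dennisUpdate`).

Conversely, `c·s > 0` suffices for a positive definite `W` with `W s = c`
(`exists_posDef_mulVec_eq`), and the sign of `c` does not affect the update. -/

namespace GaussQN

/-! ### Densities of nondegenerate Gaussians. -/

open scoped RealInnerProductSpace MatrixOrder ENNReal

section

variable {ι : Type*} [Fintype ι] [DecidableEq ι]

theorem gaussianDensity_one (x : ι → ℝ) :
    gaussianDensity (1 : Matrix ι ι ℝ) x =
      (Real.sqrt ((2 * Real.pi) ^ Fintype.card ι))⁻¹ * Real.exp (-(x ⬝ᵥ x) / 2) := by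
  simp [gaussianDensity]

@[fun_prop]
theorem continuous_gaussianDensity (Λ : Matrix ι ι ℝ) : Continuous (gaussianDensity Λ) := by
  unfold gaussianDensity
  fun_prop

@[fun_prop]
theorem measurable_gaussianDensity (Λ : Matrix ι ι ℝ) : Measurable (gaussianDensity Λ) :=
  (continuous_gaussianDensity Λ).measurable

theorem gaussianDensity_pos {Λ : Matrix ι ι ℝ} (hΛ : Λ.PosDef) (x : ι → ℝ) :
    0 < gaussianDensity Λ x := by
  have := hΛ.det_pos
  unfold gaussianDensity
  positivity

theorem gaussianDensity_neg (Λ : Matrix ι ι ℝ) (x : ι → ℝ) :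
    gaussianDensity Λ (-x) = gaussianDensity Λ x := by
  simp [gaussianDensity, mulVec_neg]

theorem gaussianDensity_le {Λ : Matrix ι ι ℝ} (hΛ : Λ.PosDef) (x : ι → ℝ) :
    gaussianDensity Λ x ≤ (Real.sqrt ((2 * Real.pi) ^ Fintype.card ι * Λ.det))⁻¹ := by
  have h : 0 ≤ x ⬝ᵥ (Λ⁻¹ *ᵥ x) := by
    simpa using hΛ.inv.posSemidef.dotProduct_mulVec_nonneg x
  unfold gaussianDensity
  refine mul_le_of_le_one_right (by positivity) (Real.exp_le_one_iff.2 ?_)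
  linarith

theorem dotProduct_ofLp_self {ι : Type*} [Fintype ι] (x : EuclideanSpace ℝ ι) : x.ofLp ⬝ᵥ x.ofLp = ‖x‖ ^ 2 := by
  rw [EuclideanSpace.real_norm_sq_eq]
  simp [dotProduct, sq]

theorem integrable_gaussianDensity_one :
    Integrable (fun x : EuclideanSpace ℝ ι => gaussianDensity (1 : Matrix ι ι ℝ) x.ofLp) := by
  have h := (GaussianFourier.integrable_cexp_neg_mul_sq_norm_add (V := EuclideanSpace ℝ ι) (b := 1 / 2)
    (by norm_num) 0 0).norm
  simp_rw [gaussianDensity_one, dotProduct_ofLp_self]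
  refine (h.congr (ae_of_all _ fun x => ?_)).const_mul _
  simp only [Complex.norm_exp]
  congr 1
  rw [show (-(1 / 2 : ℂ) * (‖x‖ : ℂ) ^ 2 + 0 * (⟪(0 : EuclideanSpace ℝ ι), x⟫ : ℝ)) =
    ((-(1 / 2) * ‖x‖ ^ 2 : ℝ) : ℂ) by push_cast; ring, Complex.ofReal_re]
  ring

/-- Both sides have the same characteristic function, by the Gaussian Fourier integral. -/
theorem stdGaussian_eq_withDensity :
    stdGaussian (EuclideanSpace ℝ ι) = (volume : Measure (EuclideanSpace ℝ ι)).withDensity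
      (fun x => ENNReal.ofReal (gaussianDensity (1 : Matrix ι ι ℝ) x.ofLp)) := by
  have hfin : IsFiniteMeasure ((volume : Measure (EuclideanSpace ℝ ι)).withDensity
      (fun x => ENNReal.ofReal (gaussianDensity (1 : Matrix ι ι ℝ) x.ofLp))) :=
    isFiniteMeasure_withDensity_ofReal integrable_gaussianDensity_one.2
  refine Measure.ext_of_charFun (funext fun t => ?_)
  rw [charFun_stdGaussian, charFun_apply, integral_withDensity_eq_integral_toReal_smul
    (by fun_prop) (by simp)]
  have h := GaussianFourier.integral_cexp_neg_mul_sq_norm_add_of_euclideanSpace (ι := ι) (b := 1 / 2)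
    (by norm_num) Complex.I t
  have hC : (Real.pi / (1 / 2) : ℂ) ^ (Fintype.card ι / 2 : ℂ) =
      (Real.sqrt ((2 * Real.pi) ^ Fintype.card ι) : ℝ) := by
    rw [Real.sqrt_eq_rpow, ← Real.rpow_natCast_mul (by positivity),
      Complex.ofReal_cpow (by positivity)]
    congr 1 <;> push_cast <;> ring
  rw [hC] at h
  have hpos : 0 < Real.sqrt ((2 * Real.pi) ^ Fintype.card ι) := by positivity
  have hint : ∀ x : EuclideanSpace ℝ ι,
      (ENNReal.ofReal (gaussianDensity (1 : Matrix ι ι ℝ) x.ofLp)).toReal •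
        Complex.exp (⟪x, t⟫ * Complex.I) =
      ((Real.sqrt ((2 * Real.pi) ^ Fintype.card ι))⁻¹ : ℝ) *
        Complex.exp (-(1 / 2) * ‖x‖ ^ 2 + Complex.I * ⟪t, x⟫) := fun x => by
    rw [ENNReal.toReal_ofReal (gaussianDensity_pos Matrix.PosDef.one _).le, gaussianDensity_one,
      dotProduct_ofLp_self, real_inner_comm, Complex.exp_add, Complex.real_smul]
    push_cast
    rw [mul_assoc]
    congr 3 <;> ring_nf
  simp_rw [hint]
  rw [integral_const_mul, h, ← mul_assoc, ← Complex.ofReal_mul, inv_mul_cancel₀ hpos.ne',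
    Complex.ofReal_one, one_mul, Complex.I_sq]
  congr 1
  ring

theorem det_sqrt {Λ : Matrix ι ι ℝ} (hΛ : Λ.PosSemidef) :
    (CFC.sqrt Λ).det = Real.sqrt Λ.det := by
  have h : (CFC.sqrt Λ).det * (CFC.sqrt Λ).det = Λ.det := by
    rw [← det_mul, CFC.sqrt_mul_sqrt_self _ hΛ.nonneg]
  have h0 : 0 ≤ (CFC.sqrt Λ).det := (nonneg_iff_posSemidef.1 (CFC.sqrt_nonneg Λ)).det_nonneg
  rw [← h, Real.sqrt_mul_self h0]

/-- Gives `√Λ x → 0` as `Λ → 0` without any continuity of the matrix square root: the right side is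
linear in `Λ`. -/
theorem norm_sq_sqrt_apply {Λ : Matrix ι ι ℝ} (hΛ : Λ.PosSemidef) (x : EuclideanSpace ℝ ι) :
    ‖toEuclideanCLM (𝕜 := ℝ) (CFC.sqrt Λ) x‖ ^ 2 = x.ofLp ⬝ᵥ Λ *ᵥ x.ofLp := by
  rw [← inner_toEuclideanCLM, ← CFC.sqrt_mul_sqrt_self Λ hΛ.nonneg, map_mul,
    mul_apply_eq_comp, ← ContinuousLinearMap.adjoint_inner_left,
    IsSelfAdjoint.adjoint_eq, CFC.sqrt_mul_sqrt_self Λ hΛ.nonneg, real_inner_self_eq_norm_sq]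
  exact (CFC.sqrt_nonneg Λ).isSelfAdjoint.map _

theorem gaussianDensity_sqrt_apply {Λ : Matrix ι ι ℝ} (hΛ : Λ.PosDef) (x : EuclideanSpace ℝ ι) :
    Real.sqrt Λ.det * gaussianDensity Λ (toEuclideanCLM (𝕜 := ℝ) (CFC.sqrt Λ) x).ofLp =
      gaussianDensity 1 x.ofLp := by
  have hS : CFC.sqrt Λ * CFC.sqrt Λ = Λ := CFC.sqrt_mul_sqrt_self Λ hΛ.posSemidef.nonneg
  have hu : IsUnit Λ.det := hΛ.det_pos.ne'.isUnit
  have hT : (CFC.sqrt Λ)ᵀ = CFC.sqrt Λ := by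
    have := (CFC.sqrt_nonneg Λ).isSelfAdjoint.star_eq
    rwa [star_eq_conjTranspose, conjTranspose_eq_transpose_of_trivial] at this
  have hI : CFC.sqrt Λ * (Λ⁻¹ * CFC.sqrt Λ) = 1 := by
    have hsu : IsUnit (CFC.sqrt Λ).det := by
      rw [det_sqrt hΛ.posSemidef]
      exact (Real.sqrt_pos.2 hΛ.det_pos).ne'.isUnit
    have : Λ⁻¹ = (CFC.sqrt Λ)⁻¹ * (CFC.sqrt Λ)⁻¹ := by rw [← Matrix.mul_inv_rev, hS]
    rw [this, Matrix.mul_assoc, nonsing_inv_mul _ hsu, Matrix.mul_one, mul_nonsing_inv _ hsu]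
  have hq : (CFC.sqrt Λ *ᵥ x.ofLp) ⬝ᵥ (Λ⁻¹ *ᵥ (CFC.sqrt Λ *ᵥ x.ofLp)) = x.ofLp ⬝ᵥ x.ofLp := by
    rw [mulVec_mulVec, ← vecMul_transpose, hT, ← dotProduct_mulVec, mulVec_mulVec, hI, one_mulVec]
  rw [gaussianDensity_one, gaussianDensity, ofLp_toEuclideanCLM, hq,
    Real.sqrt_mul (by positivity), mul_inv]
  have := (Real.sqrt_pos.2 hΛ.det_pos).ne'
  field_simp

/-- Change of variables along `x ↦ m + √Λ x`, which pushes the standard Gaussian to the left side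
and has Jacobian `√(det Λ)`. -/
theorem multivariateGaussian_eq_withDensity {Λ : Matrix ι ι ℝ} (hΛ : Λ.PosDef)
    (m : EuclideanSpace ℝ ι) :
    multivariateGaussian m Λ = (volume : Measure (EuclideanSpace ℝ ι)).withDensity
      (fun x => ENNReal.ofReal (gaussianDensity Λ (x - m).ofLp)) := by
  have hd : 0 < Real.sqrt Λ.det := Real.sqrt_pos.2 hΛ.det_pos
  have hdet : LinearMap.det
      (toEuclideanCLM (𝕜 := ℝ) (CFC.sqrt Λ)).toLinearMap = Real.sqrt Λ.det := by
    rw [coe_toEuclideanCLM_eq_toEuclideanLin, ← det_sqrt hΛ.posSemidef]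
    exact LinearMap.det_toLpLin 2 _
  have hvol := Measure.map_linearMap_addHaar_eq_smul_addHaar
    (volume : Measure (EuclideanSpace ℝ ι)) (hdet ▸ hd.ne')
  rw [hdet] at hvol
  refine Measure.ext_of_lintegral _ fun f hf => ?_
  rw [multivariateGaussian, lintegral_map hf (by fun_prop), stdGaussian_eq_withDensity,
    lintegral_withDensity_eq_lintegral_mul _ (by fun_prop) (by fun_prop),
    lintegral_withDensity_eq_lintegral_mul _ (by fun_prop) hf,
    ← lintegral_add_left_eq_self (μ := volume)
      ((fun x => ENNReal.ofReal (gaussianDensity Λ (x - m).ofLp)) * f) m]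
  have key : ∀ x : EuclideanSpace ℝ ι, ENNReal.ofReal (gaussianDensity 1 x.ofLp) *
      f (m + toEuclideanCLM (𝕜 := ℝ) (CFC.sqrt Λ) x) = ENNReal.ofReal (Real.sqrt Λ.det) *
      (fun z : EuclideanSpace ℝ ι => ENNReal.ofReal (gaussianDensity Λ z.ofLp) * f (m + z))
        ((toEuclideanCLM (𝕜 := ℝ) (CFC.sqrt Λ)).toLinearMap x) := fun x => by
    rw [← gaussianDensity_sqrt_apply hΛ, ENNReal.ofReal_mul hd.le, mul_assoc]
    rfl
  simp only [Pi.mul_apply, key, add_sub_cancel_left]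
  rw [lintegral_const_mul _ (by fun_prop), ← lintegral_map (f := fun z : EuclideanSpace ℝ ι =>
      ENNReal.ofReal (gaussianDensity Λ z.ofLp) * f (m + z)) (by fun_prop) (by fun_prop), hvol,
    lintegral_smul_measure, smul_eq_mul, ← mul_assoc, ← ENNReal.ofReal_mul hd.le,
    abs_of_pos (by positivity), mul_inv_cancel₀ hd.ne', ENNReal.ofReal_one, one_mul]

end

/-! ### The vanishing-noise limit. -/

section

variable {ι : Type*} [Fintype ι] [DecidableEq ι]

theorem integral_multivariateGaussian {Λ : Matrix ι ι ℝ} (hΛ : Λ.PosDef)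
    (m : EuclideanSpace ℝ ι) (k : EuclideanSpace ℝ ι → ℝ) :
    ∫ x, k x ∂(multivariateGaussian m Λ) = ∫ x, gaussianDensity Λ (x - m).ofLp * k x := by
  rw [multivariateGaussian_eq_withDensity hΛ, integral_withDensity_eq_integral_toReal_smul
    (by fun_prop) (by simp)]
  simp_rw [ENNReal.toReal_ofReal (gaussianDensity_pos hΛ _).le, smul_eq_mul]

/-- Gaussian measures converge weakly to the Dirac measure at their mean as the covariance
tends to zero. -/
theorem tendsto_integral_multivariateGaussian (m : EuclideanSpace ℝ ι)
    (k : BoundedContinuousFunction (EuclideanSpace ℝ ι) ℝ) :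
    Tendsto (fun Λ => ∫ x, k x ∂(multivariateGaussian m Λ))
      (𝓝[{Λ : Matrix ι ι ℝ | Λ.PosDef}] 0) (𝓝 (k m)) := by
  -- Dominated convergence along a filter needs it to be countably generated.
  have : (𝓝[{Λ : Matrix ι ι ℝ | Λ.PosDef}] (0 : Matrix ι ι ℝ)).IsCountablyGenerated := by
    have : FirstCountableTopology (Matrix ι ι ℝ) :=
      inferInstanceAs (FirstCountableTopology (ι → ι → ℝ))
    infer_instance
  have h1 : ∀ Λ : Matrix ι ι ℝ, ∫ x, k x ∂(multivariateGaussian m Λ) =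
      ∫ x, k (m + toEuclideanCLM (𝕜 := ℝ) (CFC.sqrt Λ) x)
        ∂(stdGaussian (EuclideanSpace ℝ ι)) := fun Λ =>
    integral_map (by fun_prop) k.continuous.aestronglyMeasurable
  simp_rw [h1]
  have h2 : k m = ∫ _, k m ∂(stdGaussian (EuclideanSpace ℝ ι)) := by simp
  rw [h2]
  refine tendsto_integral_filter_of_dominated_convergence (fun _ => ‖k‖)
    (Eventually.of_forall fun Λ => Continuous.aestronglyMeasurable (by fun_prop))
    (Eventually.of_forall fun Λ => ae_of_all _ fun x => k.norm_coe_le_norm _)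
    (integrable_const _) (ae_of_all _ fun x => ?_)
  refine (k.continuous.tendsto m).comp ?_
  suffices h : Tendsto (fun Λ : Matrix ι ι ℝ => toEuclideanCLM (𝕜 := ℝ) (CFC.sqrt Λ) x)
      (𝓝[{Λ : Matrix ι ι ℝ | Λ.PosDef}] 0) (𝓝 0) by simpa using h.const_add m
  have hq : Tendsto (fun Λ : Matrix ι ι ℝ => Real.sqrt (x.ofLp ⬝ᵥ Λ *ᵥ x.ofLp))
      (𝓝[{Λ : Matrix ι ι ℝ | Λ.PosDef}] 0) (𝓝 0) := by
    have hc : Continuous fun Λ : Matrix ι ι ℝ => Real.sqrt (x.ofLp ⬝ᵥ Λ *ᵥ x.ofLp) := by fun_prop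
    simpa using (hc.tendsto 0).mono_left nhdsWithin_le_nhds
  refine squeeze_zero_norm' (eventually_nhdsWithin_of_forall fun Λ (hΛ : Λ.PosDef) => ?_) hq
  rw [← norm_sq_sqrt_apply hΛ.posSemidef, Real.sqrt_sq (norm_nonneg _)]

variable {E : Type*} [NormedAddCommGroup E] [InnerProductSpace ℝ E] [MeasurableSpace E]
  [BorelSpace E] [SecondCountableTopology E]

/-- If `v - K (A v)` is independent of the Gaussian observable `A v`, the integrals against the
Gaussian likelihood of the observation `y` converge as the noise vanishes. -/
theorem tendsto_integral_likelihood {P : Measure E} [IsProbabilityMeasure P]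
    {A : E →L[ℝ] EuclideanSpace ℝ ι} {K : EuclideanSpace ℝ ι →L[ℝ] E}
    (hind : IndepFun (fun v => v - K (A v)) A P)
    {a : EuclideanSpace ℝ ι} {G : Matrix ι ι ℝ} (hG : G.PosDef)
    (hA : P.map A = multivariateGaussian a G) (y : EuclideanSpace ℝ ι)
    (f : BoundedContinuousFunction E ℝ) :
    Tendsto (fun Λ => ∫ v, gaussianDensity Λ (y - A v).ofLp * f v ∂P)
      (𝓝[{Λ : Matrix ι ι ℝ | Λ.PosDef}] 0)
      (𝓝 (gaussianDensity G (y - a).ofLp * ∫ v, f (v - K (A v) + K y) ∂P)) := by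
  set PZ := P.map (fun v => v - K (A v)) with hPZ
  have hZp : IsProbabilityMeasure PZ := Measure.isProbabilityMeasure_map (by fun_prop)
  have hprod : P.map (fun v => (v - K (A v), A v)) = PZ.prod (multivariateGaussian a G) := by
    rw [← hA]
    exact (indepFun_iff_map_prod_eq_prod_map_map (by fun_prop) (by fun_prop)).1 hind
  have hH : ∀ b, ∫ z, f (z + K b) ∂PZ = ∫ v, f (v - K (A v) + K b) ∂P := fun b =>
    integral_map (by fun_prop) (Continuous.aestronglyMeasurable (by fun_prop))
  have hHc : Continuous fun b => ∫ z, f (z + K b) ∂PZ :=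
    continuous_of_dominated (bound := fun _ => ‖f‖)
      (fun b => Continuous.aestronglyMeasurable (by fun_prop))
      (fun b => ae_of_all _ fun z => f.norm_coe_le_norm _) (integrable_const _)
      (ae_of_all _ fun z => by fun_prop)
  have hHb : ∀ b, ‖∫ z, f (z + K b) ∂PZ‖ ≤ ‖f‖ := fun b => by
    simpa using norm_integral_le_of_norm_le_const (μ := PZ)
      (ae_of_all _ fun z => f.norm_coe_le_norm (z + K b))
  -- The density of the observation at `b` times the expectation of `f` given `A v = b`; bounded and
  -- continuous, so it can be tested against the collapsing Gaussian.
  let k : BoundedContinuousFunction (EuclideanSpace ℝ ι) ℝ :=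
    BoundedContinuousFunction.ofNormedAddCommGroup
      (fun b => gaussianDensity G (b - a).ofLp * ∫ z, f (z + K b) ∂PZ)
      (by fun_prop) ((Real.sqrt ((2 * Real.pi) ^ Fintype.card ι * G.det))⁻¹ * ‖f‖) (fun b => by
        rw [norm_mul, Real.norm_of_nonneg (gaussianDensity_pos hG _).le]
        exact mul_le_mul (gaussianDensity_le hG _) (hHb b) (norm_nonneg _) (by positivity))
  have hk := tendsto_integral_multivariateGaussian y k
  have hky : k y = gaussianDensity G (y - a).ofLp * ∫ v, f (v - K (A v) + K y) ∂P := by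
    rw [← hH]; rfl
  rw [hky] at hk
  refine hk.congr' (eventually_nhdsWithin_of_forall fun Λ (hΛ : Λ.PosDef) => ?_)
  have hbd : ∀ p : E × EuclideanSpace ℝ ι,
      ‖gaussianDensity Λ (y - p.2).ofLp * f (p.1 + K p.2)‖ ≤
        (Real.sqrt ((2 * Real.pi) ^ Fintype.card ι * Λ.det))⁻¹ * ‖f‖ := fun p => by
    rw [norm_mul, Real.norm_of_nonneg (gaussianDensity_pos hΛ _).le]
    exact mul_le_mul (gaussianDensity_le hΛ _) (f.norm_coe_le_norm _) (norm_nonneg _)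
      (by positivity)
  have hcont : Continuous fun p : E × EuclideanSpace ℝ ι =>
      gaussianDensity Λ (y - p.2).ofLp * f (p.1 + K p.2) := by fun_prop
  calc ∫ b, k b ∂(multivariateGaussian y Λ)
      = ∫ b, gaussianDensity Λ (b - y).ofLp *
          (gaussianDensity G (b - a).ofLp * ∫ z, f (z + K b) ∂PZ) :=
        integral_multivariateGaussian hΛ y k
    _ = ∫ b, gaussianDensity Λ (y - b).ofLp * ∫ z, f (z + K b) ∂PZ
          ∂(multivariateGaussian a G) := by
        -- The noise density is even, so the roles of noise and observation law can be exchanged.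
        rw [integral_multivariateGaussian hG]
        refine integral_congr_ae (ae_of_all _ fun b => ?_)
        simp only
        rw [← neg_sub y b, WithLp.ofLp_neg, gaussianDensity_neg]
        ring
    _ = ∫ p, gaussianDensity Λ (y - p.2).ofLp * f (p.1 + K p.2)
          ∂(PZ.prod (multivariateGaussian a G)) := by
        rw [integral_prod_symm]
        · simp_rw [integral_const_mul]
        · exact Integrable.of_bound hcont.aestronglyMeasurable _ (ae_of_all _ hbd)
    _ = ∫ v, gaussianDensity Λ (y - A v).ofLp * f v ∂P := by
        rw [← hprod, integral_map (by fun_prop) hcont.aestronglyMeasurable]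
        simp

end

/-! ### Linear images of Gaussians and independence of the residual. -/

section Matrices

variable {ι κ : Type*} [Fintype ι] [Fintype κ] [DecidableEq κ]

/-- The continuous linear map between Euclidean spaces given by a matrix. -/
noncomputable def euclideanMap (M : Matrix ι κ ℝ) : EuclideanSpace ℝ κ →L[ℝ] EuclideanSpace ℝ ι :=
  (toLpLin 2 2 M).toContinuousLinearMap

@[simp]
theorem ofLp_euclideanMap (M : Matrix ι κ ℝ) (x : EuclideanSpace ℝ κ) :
    (euclideanMap M x).ofLp = M *ᵥ x.ofLp := rfl

variable [DecidableEq ι]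

theorem inner_euclideanMap_left (M : Matrix ι κ ℝ) (x : EuclideanSpace ℝ κ)
    (t : EuclideanSpace ℝ ι) : ⟪euclideanMap M x, t⟫ = ⟪x, euclideanMap Mᵀ t⟫ := by
  simp only [EuclideanSpace.inner_eq_star_dotProduct, ofLp_euclideanMap, star_trivial]
  rw [dotProduct_mulVec, ← mulVec_transpose]

theorem map_euclideanMap_multivariateGaussian {C : Matrix κ κ ℝ} (hC : C.PosSemidef)
    (m : EuclideanSpace ℝ κ) (M : Matrix ι κ ℝ) :
    (multivariateGaussian m C).map (euclideanMap M) =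
      multivariateGaussian (euclideanMap M m) (M * C * Mᵀ) := by
  have hG : (M * C * Mᵀ).PosSemidef := by
    simpa using hC.mul_mul_conjTranspose_same M
  refine Measure.ext_of_charFun (funext fun t => ?_)
  rw [charFun_multivariateGaussian hG, charFun_apply,
    integral_map (by fun_prop) (Continuous.aestronglyMeasurable (by fun_prop))]
  simp_rw [inner_euclideanMap_left]
  rw [← charFun_apply, charFun_multivariateGaussian hC, real_inner_comm _ (euclideanMap Mᵀ t),
    ← inner_euclideanMap_left, real_inner_comm]
  congr 4
  rw [ofLp_euclideanMap, mulVec_transpose, ← dotProduct_mulVec, ← mulVec_transpose,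
    mulVec_mulVec, mulVec_mulVec, Matrix.mul_assoc]

/-- For jointly Gaussian vectors zero covariance suffices, and the cross covariance here is `C Mᵀ -
K M C Mᵀ = 0`. -/
theorem indepFun_sub_multivariateGaussian {C : Matrix κ κ ℝ} (hC : C.PosSemidef)
    (m : EuclideanSpace ℝ κ) (M : Matrix ι κ ℝ) (K : Matrix κ ι ℝ)
    (hK : K * (M * C * Mᵀ) = C * Mᵀ) :
    IndepFun (fun v => v - euclideanMap K (euclideanMap M v)) (euclideanMap M)
      (multivariateGaussian m C) := by
  have hlaw : HasGaussianLaw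
      (fun v => (v - euclideanMap K (euclideanMap M v), euclideanMap M v))
      (multivariateGaussian m C) :=
    ⟨isGaussian_map (((ContinuousLinearMap.id ℝ _) - (euclideanMap K).comp (euclideanMap M)).prod
      (euclideanMap M))⟩
  refine hlaw.indepFun_of_covariance_inner fun x t => ?_
  have h1 : ∀ v, ⟪x, v - euclideanMap K (euclideanMap M v)⟫ =
      ⟪x - euclideanMap Mᵀ (euclideanMap Kᵀ x), v⟫ := fun v => by
    rw [inner_sub_right, inner_sub_left, real_inner_comm, real_inner_comm _ x,
      inner_euclideanMap_left, inner_euclideanMap_left, real_inner_comm v]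
  have h2 : ∀ v, ⟪t, euclideanMap M v⟫ = ⟪euclideanMap Mᵀ t, v⟫ := fun v => by
    rw [real_inner_comm, inner_euclideanMap_left, real_inner_comm]
  simp_rw [h1, h2]
  rw [← covarianceBilin_apply_eq_cov IsGaussian.memLp_two_id,
    covarianceBilin_multivariateGaussian hC]
  simp only [WithLp.ofLp_sub, ofLp_euclideanMap, sub_dotProduct]
  have h3 : ∀ z : ι → ℝ, (Mᵀ *ᵥ (Kᵀ *ᵥ x.ofLp)) ⬝ᵥ (C *ᵥ (Mᵀ *ᵥ z)) =
      x.ofLp ⬝ᵥ ((K * (M * C * Mᵀ)) *ᵥ z) := fun z => by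
    rw [mulVec_transpose, ← dotProduct_mulVec, mulVec_transpose, ← dotProduct_mulVec]
    simp only [mulVec_mulVec, Matrix.mul_assoc]
  rw [h3, hK, mulVec_mulVec, sub_self]

end Matrices

/-! ### Posterior and posterior mean for a linear observation. -/

/-- The matrix of the linear map `B ↦ B * S` on vectors of matrix elements. -/
def observationMatrix {N M : ℕ} (S : Matrix (Fin N) (Fin M) ℝ) :
    Matrix (Fin N × Fin M) (Fin N × Fin N) ℝ :=
  Matrix.of fun p q => if p.1 = q.1 then S q.2 p.2 else 0

theorem euclideanMap_observationMatrix {N M : ℕ} (S : Matrix (Fin N) (Fin M) ℝ)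
    (v : EuclideanSpace ℝ (Fin N × Fin N)) :
    euclideanMap (observationMatrix S) v = rowVec (unVec v * S) := by
  ext p
  simp [rowVec, unVec, observationMatrix, mulVec, dotProduct, Matrix.mul_apply,
    Fintype.sum_prod_type, mul_comm]

theorem likelihood_eq {N M : ℕ} (S Y : Matrix (Fin N) (Fin M) ℝ)
    (Λ : Matrix (Fin N × Fin M) (Fin N × Fin M) ℝ) (v : EuclideanSpace ℝ (Fin N × Fin N)) :
    likelihood S Y Λ v =
      gaussianDensity Λ (rowVec Y - euclideanMap (observationMatrix S) v).ofLp := by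
  rw [euclideanMap_observationMatrix]
  rfl

theorem integral_noisyPosterior {N M : ℕ} (P : Measure (EuclideanSpace ℝ (Fin N × Fin N)))
    [IsProbabilityMeasure P] (S Y : Matrix (Fin N) (Fin M) ℝ)
    {Λ : Matrix (Fin N × Fin M) (Fin N × Fin M) ℝ} (hΛ : Λ.PosDef)
    (f : EuclideanSpace ℝ (Fin N × Fin N) → ℝ) :
    ∫ v, f v ∂(noisyPosterior P S Y Λ) =
      (∫ v, likelihood S Y Λ v ∂P)⁻¹ * ∫ v, likelihood S Y Λ v * f v ∂P := by
  have hpos : ∀ v, 0 ≤ likelihood S Y Λ v := fun v => (gaussianDensity_pos hΛ _).le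
  have hcont : Continuous (likelihood S Y Λ) := by
    rw [funext (likelihood_eq S Y Λ)]
    fun_prop
  have hint : Integrable (likelihood S Y Λ) P :=
    Integrable.of_bound hcont.aestronglyMeasurable _ (ae_of_all _ fun v => by
      rw [Real.norm_of_nonneg (hpos v)]
      exact gaussianDensity_le hΛ _)
  have hmeas := hcont.measurable
  rw [noisyPosterior, integral_smul_measure, integral_withDensity_eq_integral_toReal_smul
    (by fun_prop) (by simp), ← ofReal_integral_eq_lintegral_ofReal hint (ae_of_all _ hpos),
    ENNReal.toReal_inv, ENNReal.toReal_ofReal (integral_nonneg hpos), smul_eq_mul]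
  simp_rw [ENNReal.toReal_ofReal (hpos _), smul_eq_mul]

/-- The noise-free posterior of a Gaussian prior: the prior is transported by the affine map that
corrects the observation. -/
theorem isNoiseFreePosterior_multivariateGaussian {N M : ℕ}
    {C : Matrix (Fin N × Fin N) (Fin N × Fin N) ℝ} (hC : C.PosSemidef)
    (m : EuclideanSpace ℝ (Fin N × Fin N)) (S Y : Matrix (Fin N) (Fin M) ℝ)
    (K : Matrix (Fin N × Fin N) (Fin N × Fin M) ℝ)
    (hG : (observationMatrix S * C * (observationMatrix S)ᵀ).PosDef)
    (hK : K * (observationMatrix S * C * (observationMatrix S)ᵀ) = C * (observationMatrix S)ᵀ) :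
    IsNoiseFreePosterior (multivariateGaussian m C) S Y
      ((multivariateGaussian m C).map fun v => v - euclideanMap K
        (euclideanMap (observationMatrix S) v) + euclideanMap K (rowVec Y)) := by
  refine ⟨Measure.isProbabilityMeasure_map (by fun_prop), fun f => ?_⟩
  have h := tendsto_integral_likelihood (indepFun_sub_multivariateGaussian hC m _ K hK) hG
    (map_euclideanMap_multivariateGaussian hC m _) (rowVec Y)
  rw [integral_map (by fun_prop) (Continuous.aestronglyMeasurable (by fun_prop))]
  have hg := gaussianDensity_pos hG
    (rowVec Y - euclideanMap (observationMatrix S) m).ofLp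
  -- The test function `1` gives the normalizing constant, whose limit is a positive density value,
  -- so the quotient converges.
  have h1 := h (BoundedContinuousFunction.const _ 1)
  simp only [BoundedContinuousFunction.const_apply, mul_one, integral_const, probReal_univ,
    smul_eq_mul] at h1
  have h2 := (h1.inv₀ hg.ne').mul (h f)
  rw [inv_mul_cancel_left₀ hg.ne'] at h2
  refine h2.congr' (eventually_nhdsWithin_of_forall fun Λ (hΛ : Λ.PosDef) => ?_)
  simp only [integral_noisyPosterior _ S Y hΛ]
  simp_rw [likelihood_eq]

/-- The mean is `B₀ + C Aᵀ G⁻¹ (Y - B₀ S)`; supplying `u` with `G u = Y - B₀ S` spares applications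
from computing `G⁻¹`. -/
theorem isPosteriorMean_of_gain {N M : ℕ} {B₀ W : Matrix (Fin N) (Fin N) ℝ} (hW : W.PosDef)
    {S Y : Matrix (Fin N) (Fin M) ℝ}
    (hG : (observationMatrix S * symKronecker W * (observationMatrix S)ᵀ).PosDef)
    {u : Fin N × Fin M → ℝ}
    (hu : (observationMatrix S * symKronecker W * (observationMatrix S)ᵀ) *ᵥ u =
      (rowVec (Y - B₀ * S)).ofLp) {B₁ : Matrix (Fin N) (Fin N) ℝ}
    (hB₁ : (symKronecker W * (observationMatrix S)ᵀ) *ᵥ u = (rowVec (B₁ - B₀)).ofLp) :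
    IsPosteriorMean B₀ W S Y B₁ := by
  set G := observationMatrix S * symKronecker W * (observationMatrix S)ᵀ with hGdef
  set K := symKronecker W * (observationMatrix S)ᵀ * G⁻¹ with hKdef
  have hK : K * G = symKronecker W * (observationMatrix S)ᵀ := by
    rw [hKdef, Matrix.mul_assoc, nonsing_inv_mul _ hG.det_pos.ne'.isUnit, Matrix.mul_one]
  have hint : Integrable (fun v => v) (prior B₀ W) := by
    unfold prior
    exact IsGaussian.integrable_fun_id
  have hP : IsProbabilityMeasure (prior B₀ W) := by
    unfold prior
    infer_instance
  have hint2 : Integrable (fun v => euclideanMap K (euclideanMap (observationMatrix S) v))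
      (prior B₀ W) :=
    ((euclideanMap K).comp (euclideanMap (observationMatrix S))).integrable_comp hint
  refine ⟨_, isNoiseFreePosterior_multivariateGaussian (posSemidef_symKronecker hW) _ S Y K hG hK,
    ?_, ?_⟩
  · rw [integrable_map_measure (by fun_prop) (by fun_prop)]
    exact (hint.sub hint2).add (integrable_const _)
  · rw [integral_map (by fun_prop) (by fun_prop)]
    change ∫ v, v - euclideanMap K (euclideanMap (observationMatrix S) v) +
      euclideanMap K (rowVec Y) ∂(prior B₀ W) = _
    have hm : ∫ v, v ∂(prior B₀ W) = rowVec B₀ := integral_id_multivariateGaussian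
    have hm2 := ((euclideanMap K).comp
      (euclideanMap (observationMatrix S))).integral_comp_comm hint
    simp only [ContinuousLinearMap.comp_apply] at hm2
    have hsub : Integrable (fun v => v - euclideanMap K
        (euclideanMap (observationMatrix S) v)) (prior B₀ W) := hint.sub hint2
    rw [integral_add hsub (integrable_const _), integral_sub hint hint2, hm2, hm,
      integral_const, probReal_univ, one_smul, sub_add, ← map_sub,
      euclideanMap_observationMatrix]
    have hr : (rowVec (unVec (rowVec B₀) * S) - rowVec Y).ofLp =
        -(rowVec (Y - B₀ * S)).ofLp := by
      ext p
      simp [rowVec, unVec]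
      rfl
    have hKu : euclideanMap K (rowVec (unVec (rowVec B₀) * S) - rowVec Y) =
        -rowVec (B₁ - B₀) := by
      apply WithLp.ofLp_injective
      rw [ofLp_euclideanMap, hr, mulVec_neg, ← hu, mulVec_mulVec, hK, hB₁]
      rfl
    rw [hKu]
    ext p
    simp [rowVec]

/-! ### One observation and the Dennis update. -/

section OneStep

variable {N : ℕ}

theorem symKronecker_mul_observationMatrix_apply {W : Matrix (Fin N) (Fin N) ℝ}
    (s : Fin N → ℝ) (i j k : Fin N) (o : Fin 1) :
    (symKronecker W * (observationMatrix (replicateCol (Fin 1) s))ᵀ) (i, j) (k, o) =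
      (W i k * (W *ᵥ s) j + W j k * (W *ᵥ s) i) / 2 := by
  simp only [Matrix.mul_apply, Fintype.sum_prod_type, symKronecker_apply, observationMatrix,
    transpose_apply, of_apply, replicateCol_apply, mul_ite, mul_zero, mulVec, dotProduct,
    Finset.mul_sum]
  rw [Finset.sum_eq_single k (by intro b _ hb; simp [Ne.symm hb]) (by simp)]
  simp only [if_true]
  rw [← Finset.sum_add_distrib, Finset.sum_div]
  exact Finset.sum_congr rfl fun l _ => by ring

theorem observationMatrix_mul_symKronecker_mul {W : Matrix (Fin N) (Fin N) ℝ}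
    (hW : W.PosDef) (s : Fin N → ℝ) :
    observationMatrix (replicateCol (Fin 1) s) * symKronecker W *
        (observationMatrix (replicateCol (Fin 1) s))ᵀ =
      ((2⁻¹ : ℝ) • (((W *ᵥ s) ⬝ᵥ s) • W + vecMulVec (W *ᵥ s) (W *ᵥ s))).submatrix
        Prod.fst Prod.fst := by
  have hWs : ∀ i j, W i j = W j i := fun i j => by simpa using (hW.isHermitian.apply j i)
  rw [Matrix.mul_assoc]
  ext ⟨i, o⟩ ⟨k, o'⟩
  rw [Matrix.mul_apply, Fintype.sum_prod_type]
  simp only [symKronecker_mul_observationMatrix_apply]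
  simp only [observationMatrix, of_apply,
    replicateCol_apply, ite_mul, zero_mul]
  rw [Finset.sum_eq_single i (by intro b _ hb; simp [Ne.symm hb]) (by simp)]
  have hc : (W *ᵥ s) k = ∑ j, W j k * s j := by
    simp only [mulVec, dotProduct]
    exact Finset.sum_congr rfl fun j _ => by rw [hWs]
  simp only [if_true, submatrix_apply, Matrix.smul_apply, Matrix.add_apply, vecMulVec_apply, smul_eq_mul]
  rw [hc]
  simp only [dotProduct, Finset.sum_mul, Finset.mul_sum, ← Finset.sum_add_distrib]
  exact Finset.sum_congr rfl fun l _ => by ring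

theorem mulVec_dotProduct_pos {W : Matrix (Fin N) (Fin N) ℝ} (hW : W.PosDef) {s : Fin N → ℝ}
    (hs : s ≠ 0) : 0 < (W *ᵥ s) ⬝ᵥ s := by
  rw [dotProduct_comm]
  simpa using hW.dotProduct_mulVec_pos hs

theorem posDef_observation_covariance {W : Matrix (Fin N) (Fin N) ℝ} (hW : W.PosDef)
    {s : Fin N → ℝ} (hs : s ≠ 0) :
    (observationMatrix (replicateCol (Fin 1) s) * symKronecker W *
        (observationMatrix (replicateCol (Fin 1) s))ᵀ).PosDef := by
  rw [observationMatrix_mul_symKronecker_mul hW]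
  -- `Prod.fst` is injective because the second index lies in `Fin 1`.
  refine PosDef.submatrix (PosDef.smul ((hW.smul (mulVec_dotProduct_pos hW hs)).add_posSemidef ?_)
    (by norm_num)) fun p q h => Prod.ext h (Subsingleton.elim _ _)
  simpa using posSemidef_vecMulVec_self_star (W *ᵥ s)

/-- The posterior mean after one noise-free observation is the Dennis update with `c = W s`. -/
theorem isPosteriorMean_dennisUpdate (B₀ : Matrix (Fin N) (Fin N) ℝ)
    {W : Matrix (Fin N) (Fin N) ℝ} (hW : W.PosDef) {s : Fin N → ℝ} (hs : s ≠ 0)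
    (y : Fin N → ℝ) :
    IsPosteriorMean B₀ W (replicateCol (Fin 1) s) (replicateCol (Fin 1) y)
      (dennisUpdate B₀ s y (W *ᵥ s)) := by
  have hσ := mulVec_dotProduct_pos hW hs
  set c := W *ᵥ s with hc
  set σ := c ⬝ᵥ s with hσdef
  set r := y - B₀ *ᵥ s with hr
  -- `w` is the value forced on `W u` by `(σ W u + (c·u) c) / 2 = r`: pairing with `s` gives `c·u =
  -- (s·r) / σ`, and then one solves for `W u`.
  set w : Fin N → ℝ := (2 / σ) • r - ((s ⬝ᵥ r) / σ ^ 2) • c with hw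
  have hWT : Wᵀ = W := by simpa using hW.isHermitian.eq
  have hWu : W *ᵥ (W⁻¹ *ᵥ w) = w := by
    rw [mulVec_mulVec, mul_nonsing_inv _ hW.det_pos.ne'.isUnit, one_mulVec]
  have hcu : c ⬝ᵥ (W⁻¹ *ᵥ w) = (s ⬝ᵥ r) / σ := by
    have hcs : c = s ᵥ* W := by rw [hc, ← vecMul_transpose, hWT]
    rw [hcs, ← dotProduct_mulVec, hWu, hw, dotProduct_sub,
      dotProduct_smul, dotProduct_smul, dotProduct_comm s c, ← hσdef, smul_eq_mul, smul_eq_mul]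
    field_simp
    ring
  refine isPosteriorMean_of_gain hW (posDef_observation_covariance hW hs)
    (u := fun p => (W⁻¹ *ᵥ w) p.1) ?_ ?_
  · rw [observationMatrix_mul_symKronecker_mul hW, ← hc, ← hσdef]
    ext ⟨i, o⟩
    have h1 : ((((2⁻¹ : ℝ) • (σ • W + vecMulVec c c)).submatrix
        (Prod.fst : Fin N × Fin 1 → Fin N) (Prod.fst : Fin N × Fin 1 → Fin N)) *ᵥ
          fun p => (W⁻¹ *ᵥ w) p.1) (i, o) =
        (((2⁻¹ : ℝ) • (σ • W + vecMulVec c c)) *ᵥ (W⁻¹ *ᵥ w)) i := by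
      simp only [mulVec, dotProduct, submatrix_apply, Fintype.sum_prod_type]
      simp
    rw [h1, smul_mulVec, add_mulVec, smul_mulVec, hWu, vecMulVec_mulVec, hcu]
    have h2 : (rowVec (replicateCol (Fin 1) y - B₀ * replicateCol (Fin 1) s)).ofLp (i, o) =
        r i := by
      simp [rowVec, hr, Matrix.mul_apply, mulVec, dotProduct]
    rw [h2]
    simp [hw]
    field_simp
    ring
  · ext ⟨i, j⟩
    have h1 : ((symKronecker W * (observationMatrix (replicateCol (Fin 1) s))ᵀ) *ᵥ
        fun p : Fin N × Fin 1 => (W⁻¹ *ᵥ w) p.1) (i, j) =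
        ((W *ᵥ (W⁻¹ *ᵥ w)) i * c j + (W *ᵥ (W⁻¹ *ᵥ w)) j * c i) / 2 := by
      rw [mulVec, dotProduct, Fintype.sum_prod_type]
      simp only [symKronecker_mul_observationMatrix_apply, Fintype.sum_unique, ← hc]
      simp only [mulVec.eq_1 W (W⁻¹ *ᵥ w), dotProduct.eq_1 (W _), Finset.sum_mul,
        ← Finset.sum_add_distrib, Finset.sum_div]
      exact Finset.sum_congr rfl fun l _ => by ring
    rw [h1, hWu]
    simp [rowVec, dennisUpdate, hw, vecMulVec_apply, ← hr, ← hσdef]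
    field_simp
    ring

theorem dennisUpdate_smul (B₀ : Matrix (Fin N) (Fin N) ℝ) (s y c : Fin N → ℝ) {α : ℝ}
    (hα : α ≠ 0) : dennisUpdate B₀ s y (α • c) = dennisUpdate B₀ s y c := by
  -- Here division by zero makes both sides `B₀`.
  by_cases h : c ⬝ᵥ s = 0
  · simp [dennisUpdate, h]
  ext i j
  simp [dennisUpdate, vecMulVec_apply, smul_dotProduct]
  field_simp

/-- The witness is the BFGS update of the identity. Its quadratic form at `x` is the squared norm of
the part of `x` orthogonal to `s`, plus `(c·x)² / (c·s)`; where the first term vanishes, `x` is a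
nonzero multiple of `s` and the second is positive. -/
theorem exists_posDef_mulVec_eq {s c : Fin N → ℝ} (h : 0 < c ⬝ᵥ s) :
    ∃ W : Matrix (Fin N) (Fin N) ℝ, W.PosDef ∧ W *ᵥ s = c := by
  have hs : s ≠ 0 := by rintro rfl; simp at h
  have hss : 0 < s ⬝ᵥ s := by simpa using dotProduct_star_self_pos_iff.2 hs
  refine ⟨1 - (s ⬝ᵥ s)⁻¹ • vecMulVec s s + (c ⬝ᵥ s)⁻¹ • vecMulVec c c, ?_, ?_⟩
  · refine PosDef.of_dotProduct_mulVec_pos ?_ fun {x} hx => ?_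
    · ext i j
      simp [vecMulVec_apply, Matrix.one_apply, eq_comm, mul_comm]
    · simp only [star_trivial, add_mulVec, sub_mulVec, one_mulVec, smul_mulVec, vecMulVec_mulVec,
        dotProduct_add, dotProduct_sub, dotProduct_smul]
      simp
      rw [dotProduct_comm x s, dotProduct_comm x c]
      set t := (s ⬝ᵥ x) / (s ⬝ᵥ s) with ht
      have hz : (x - t • s) ⬝ᵥ (x - t • s) = x ⬝ᵥ x - (s ⬝ᵥ s)⁻¹ * ((s ⬝ᵥ x) * (s ⬝ᵥ x)) := by
        simp only [dotProduct_sub, sub_dotProduct, dotProduct_smul, smul_dotProduct, smul_eq_mul,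
          dotProduct_comm x s, ht]
        field_simp
        ring
      by_cases hx0 : x - t • s = 0
      · have hxt : x = t • s := sub_eq_zero.1 hx0
        have ht0 : t ≠ 0 := fun h0 => hx (by rw [hxt, h0, zero_smul])
        have hcx : 0 < (c ⬝ᵥ x) * (c ⬝ᵥ x) := by
          refine mul_self_pos.2 ?_
          rw [hxt, dotProduct_smul, smul_eq_mul]
          exact mul_ne_zero ht0 h.ne'
        have h0 : (x - t • s) ⬝ᵥ (x - t • s) = 0 := by rw [hx0, zero_dotProduct]
        have := mul_pos (inv_pos.2 h) hcx
        linarith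
      · have h0 : 0 < (x - t • s) ⬝ᵥ (x - t • s) := by
          simpa using dotProduct_star_self_pos_iff.2 hx0
        have := mul_nonneg (inv_pos.2 h).le (mul_self_nonneg (c ⬝ᵥ x))
        linarith
  · simp only [add_mulVec, sub_mulVec, one_mulVec, smul_mulVec, vecMulVec_mulVec]
    simp [smul_smul, hss.ne', h.ne']

end OneStep

end GaussQN

theorem corollary2p4 {N : ℕ} (B₀ : Matrix (Fin N) (Fin N) ℝ) (hB₀ : B₀.IsSymm)
    (s y : Fin N → ℝ) :
    -- one-step posterior means are Dennis updates, with `c = W s`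
    (∀ W : Matrix (Fin N) (Fin N) ℝ, W.PosDef → s ≠ 0 →
      (W *ᵥ s) ⬝ᵥ s ≠ 0 ∧
      GaussQN.IsPosteriorMean B₀ W (Matrix.replicateCol (Fin 1) s) (Matrix.replicateCol (Fin 1) y)
        (GaussQN.dennisUpdate B₀ s y (W *ᵥ s))) ∧
    -- every Dennis update is a one-step posterior mean, with `W s = ± c`
    (∀ c : Fin N → ℝ, c ⬝ᵥ s ≠ 0 →
      ∃ W : Matrix (Fin N) (Fin N) ℝ, W.PosDef ∧ W *ᵥ s = Real.sign (c ⬝ᵥ s) • c ∧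
        GaussQN.IsPosteriorMean B₀ W (Matrix.replicateCol (Fin 1) s)
          (Matrix.replicateCol (Fin 1) y) (GaussQN.dennisUpdate B₀ s y c)) := by
  refine ⟨fun W hW hs => ⟨(GaussQN.mulVec_dotProduct_pos hW hs).ne',
    GaussQN.isPosteriorMean_dennisUpdate B₀ hW hs y⟩, fun c hc => ?_⟩
  have hs : s ≠ 0 := by rintro rfl; simp at hc
  have hα : Real.sign (c ⬝ᵥ s) ≠ 0 := by simpa [Real.sign_eq_zero_iff] using hc
  -- Multiplying `c` by the sign makes its pairing with `s` positive.
  obtain ⟨W, hW, hWs⟩ := GaussQN.exists_posDef_mulVec_eq (s := s)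
    (c := Real.sign (c ⬝ᵥ s) • c) (by
      rw [smul_dotProduct, smul_eq_mul]
      exact Real.sign_mul_pos_of_ne_zero _ hc)
  refine ⟨W, hW, hWs, ?_⟩
  rw [← GaussQN.dennisUpdate_smul B₀ s y c hα, ← hWs]
  exact GaussQN.isPosteriorMean_dennisUpdate B₀ hW hs y
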